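/- **Theorem 1.5 ($t$-wise independent single-item contention resolution).** Let $\mathcal D$ denote a probability distribution over subsets of $[n]=\{1,\dots,n\}$, let $R\sim\mathcal D$, and let $x_i=\Pr[i\in R]$. Call $\mathcal D$ *$t$-wise independent* if $\Pr[S\subseteq R]=\prod_{i\in S}x_i$ for every $S\subseteq[n]$ with $|S|\le t$. A *single-item contention resolution scheme* (CRS) is a randomized map $\pi$ that, given $\mathcal D$ and a set $R\subseteq[n]$, returns a random set $\pi(R)\subseteq R$ with $|\pi(R)|\le 1$. For $c\in[0,1]$ it is *$c$-balanced for $t$-wise independent distributions* if, for every $t$-wise independent $\mathcal D$ over subsets of $[n]$ with $\sum_i x_i\le 1$ and every $i$ with $x_i>0$, $$\Pr[\,i\in\pi(R)\mid i\in R\,]\ge c,$$ where the probability is over both $R\sim\mathcal D$ and the randomness of $\pi$. Let $$\phi(t):=1-\sum_{k=0}^{2\lfloor t/2\rfloor}\frac{(-1)^k}{k!}.$$ Then for every integer $t\ge1$ there is a constant $C_t$, depending only on $t$, such that for every $n\ge1$ there is a largest $c=c^*(t,n)\in[0,1]$ for which a single-item CRS on $[n]$ that is $c$-balanced for $t$-wise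 independent distributions exists, and $$\phi(t)\;\le\;c^*(t,n)\;\le\;\phi(t)+\frac{C_t}{n}.$$ In particular, $c^*(t,n)=\phi(t)+O(1/n)$ for each fixed $t$. -/

import Mathlib

noncomputable section

namespace TwiseCRS

/-- Probability of the event `A` under `D`, as a real number. -/
def prob {α : Type*} (D : PMF α) (A : Set α) : ℝ := (D.toOuterMeasure A).toReal

/-- Conditional probability `Pr[A | B]` (used only when `Pr[B] > 0`). -/
def condProb {α : Type*} (D : PMF α) (A B : Set α) : ℝ := prob D (A ∩ B) / prob D B

/-- The marginal `x_i = Pr[i ∈ R]` of a random subset `R ∼ D` of `[n]`. -/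
def marginal {n : ℕ} (D : PMF (Finset (Fin n))) (i : Fin n) : ℝ := prob D {R | i ∈ R}

/-- `t`-wise independence of the events `{i ∈ R}`: for any at most `t` distinct elements, the
probability that all are active is the product of their marginals. -/
def IsTwiseIndep {n : ℕ} (t : ℕ) (D : PMF (Finset (Fin n))) : Prop :=
  ∀ S : Finset (Fin n), S.card ≤ t → prob D {R | S ⊆ R} = ∏ i ∈ S, marginal D i

/-- The single-item polytope (the matroid polytope of the rank-one uniform matroid on `[n]`). -/
def singleItemPolytope (n : ℕ) : Set (Fin n → ℝ) := {x | (∀ i, 0 ≤ x i) ∧ ∑ i, x i ≤ 1}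

/-- An (offline, randomized) single-item contention resolution scheme on `[n]`: knowing the
distribution `D` of the active set, it maps every active set `R` to a random subset of `R` with at
most one element. -/
structure SingleItemCRS (n : ℕ) where
  select : PMF (Finset (Fin n)) → Finset (Fin n) → PMF (Finset (Fin n))
  subset : ∀ D R, ∀ I ∈ (select D R).support, I ⊆ R
  single : ∀ D R, ∀ I ∈ (select D R).support, I.card ≤ 1

/-- The joint law of `(R, π(R))` when `R ∼ D`. -/
def SingleItemCRS.jointLaw {n : ℕ} (π : SingleItemCRS n) (D : PMF (Finset (Fin n))) :
    PMF (Finset (Fin n) × Finset (Fin n)) :=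
  D.bind fun R => (π.select D R).map (Prod.mk R)

/-- `π` is `c`-balanced for `t`-wise independent distributions: `Pr[i ∈ π(R) | i ∈ R] ≥ c` for every
`t`-wise independent `D` with marginal vector in the single-item polytope and every element `i`
which is active with positive probability. -/
def SingleItemCRS.IsBalanced {n : ℕ} (π : SingleItemCRS n) (t : ℕ) (c : ℝ) : Prop :=
  ∀ D : PMF (Finset (Fin n)), IsTwiseIndep t D → marginal D ∈ singleItemPolytope n →
    ∀ i, 0 < marginal D i →
      c ≤ condProb (π.jointLaw D) {p | i ∈ p.2} {p | i ∈ p.1}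

/-- The values `c ∈ [0,1]` for which a `c`-balanced single-item scheme for `t`-wise independent
distributions over subsets of `[n]` exists. -/
def achievable (t n : ℕ) : Set ℝ :=
  {c | c ∈ Set.Icc (0 : ℝ) 1 ∧ ∃ π : SingleItemCRS n, π.IsBalanced t c}

/-- `φ(t) = 1 - ∑_{k=0}^{2⌊t/2⌋} (-1)^k / k!`. -/
def phi (t : ℕ) : ℝ :=
  1 - ∑ k ∈ Finset.range (2 * (t / 2) + 1), (-1 : ℝ) ^ k / (Nat.factorial k : ℝ)

end TwiseCRS

end

/-! Duality turns balancedness into a hitting condition: `c` is achievable iff every set `A` is hit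
with probability at least `c` times its marginal sum (`mem_achievable_iff`). This closed condition
on `c` yields a largest value.

Lower bound: with `m = 2 * (t / 2)`, Bonferroni's inequality truncated at the even order `m` needs
only `t`-wise independence. Its sum is bounded by the degree-`m` Taylor polynomial `p` of `exp (-s)`
at the marginal sum `s` of `A`, by replacing Bernoulli events with Poisson mass of equal mean one at
a time (`bonferroniSum_le_expNegTrunc`). As `p` is convex on `[0, 1]` and `p 0 = 1`, its chord gives
`1 - p s ≥ (1 - p 1) * s`, where `1 - p 1 = phi t`.

Upper bound: `extremal` is an `(m+1)`-wise independent law with marginals `1/n`, empty with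
probability at least `p 1 - O(1/n)`. Testing the hitting condition on it with `A` the whole ground
set finishes the proof. -/

noncomputable section

namespace TwiseCRS

/-! ### Truncated exponential series -/

/-- A partial alternating sum of a nonincreasing nonnegative sequence lies between `0` and its
first term. -/
theorem alternating_sum_mem_Icc (N : ℕ) (a : ℕ → ℝ) (h0 : ∀ i, 0 ≤ a i)
    (h : ∀ i, a (i + 1) ≤ a i) :
    ∑ i ∈ Finset.range N, (-1 : ℝ) ^ i * a i ∈ Set.Icc 0 (a 0) := by
  induction N generalizing a with
  | zero => simpa using h0 0
  | succ N ih =>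
    have := ih (fun i => a (i + 1)) (fun i => h0 _) (fun i => h _)
    have e : ∑ i ∈ Finset.range N, (-1 : ℝ) ^ (i + 1) * a (i + 1)
        = -∑ i ∈ Finset.range N, (-1 : ℝ) ^ i * a (i + 1) := by
      rw [← Finset.sum_neg_distrib]
      exact Finset.sum_congr rfl fun i _ => by ring
    rw [Finset.sum_range_succ', e]
    have h1 := h 0
    constructor <;> simp at this ⊢ <;> linarith [this.1, this.2]

/-- The first `j` terms of the power series of `exp (-u)`. -/
def expNegTrunc (j : ℕ) (u : ℝ) : ℝ :=
  ∑ k ∈ Finset.range j, (-1 : ℝ) ^ k * (u ^ k / (k.factorial : ℝ))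

theorem expNegTrunc_zero (u : ℝ) : expNegTrunc 0 u = 0 := by simp [expNegTrunc]

theorem expNegTrunc_succ (j : ℕ) (u : ℝ) :
    expNegTrunc (j + 1) u = expNegTrunc j u + (-1) ^ j * (u ^ j / (j.factorial : ℝ)) :=
  Finset.sum_range_succ _ _

theorem expNegTrunc_succ_zero (j : ℕ) : expNegTrunc (j + 1) 0 = 1 := by
  simp [expNegTrunc, Finset.sum_range_succ']

theorem expNegTrunc_mem_Icc (j : ℕ) {u : ℝ} (hu : u ∈ Set.Icc (0 : ℝ) 1) :
    expNegTrunc j u ∈ Set.Icc (0 : ℝ) 1 := by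
  have := alternating_sum_mem_Icc j (fun k => u ^ k / (k.factorial : ℝ))
    (fun i => by have := hu.1; positivity) (fun i => by
      have := hu.1
      have h1 := hu.2
      have hf : (0 : ℝ) < i.factorial := by positivity
      gcongr ?_ / ?_
      · exact pow_le_pow_of_le_one hu.1 hu.2 (Nat.le_succ i)
      · exact_mod_cast Nat.factorial_le (Nat.le_succ i))
  simpa [expNegTrunc] using this

theorem hasDerivAt_expNegTrunc (j : ℕ) (u : ℝ) :
    HasDerivAt (expNegTrunc j) (-expNegTrunc (j - 1) u) u := by
  induction j with
  | zero =>
    have : expNegTrunc 0 = fun _ => (0 : ℝ) := funext expNegTrunc_zero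
    simpa [this] using hasDerivAt_const u (0 : ℝ)
  | succ j ih =>
    have : expNegTrunc (j + 1) = fun u => expNegTrunc j u + (-1) ^ j * (u ^ j / (j.factorial : ℝ)) :=
      funext (expNegTrunc_succ j)
    rw [this]
    have h := ih.add ((((hasDerivAt_pow j u).div_const (j.factorial : ℝ))).const_mul ((-1 : ℝ) ^ j))
    refine h.congr_deriv ?_
    cases j with
    | zero => simp
    | succ i =>
      simp only [Nat.add_sub_cancel, expNegTrunc_succ i, Nat.factorial_succ]
      have : (i.factorial : ℝ) ≠ 0 := by positivity
      push_cast
      field_simp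
      ring

theorem phi_eq (t : ℕ) : phi t = 1 - expNegTrunc (2 * (t / 2) + 1) 1 := by
  simp [phi, expNegTrunc, div_eq_mul_inv]

theorem phi_mem_Icc (t : ℕ) : phi t ∈ Set.Icc (0 : ℝ) 1 := by
  have := expNegTrunc_mem_Icc (2 * (t / 2) + 1) (u := 1) (by simp)
  rw [phi_eq]
  constructor <;> linarith [this.1, this.2]

/-! ### Bonferroni sums and the exchange of Bernoulli events for Poisson mass -/

section Bonferroni

variable {α : Type*}

/-- The inclusion-exclusion sum truncated to order less than `j`, for independent events with
probabilities `x a`, `a ∈ A`, together with a Poisson variable of mean `u`. -/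
def bonferroniSum (x : α → ℝ) (j : ℕ) (A : Finset α) (u : ℝ) : ℝ :=
  ∑ S ∈ A.powerset, (-1 : ℝ) ^ S.card * (∏ a ∈ S, x a) * expNegTrunc (j - S.card) u

theorem bonferroniSum_empty (x : α → ℝ) (j : ℕ) (u : ℝ) :
    bonferroniSum x j ∅ u = expNegTrunc j u := by
  simp [bonferroniSum]

theorem bonferroniSum_zero (x : α → ℝ) (A : Finset α) (u : ℝ) : bonferroniSum x 0 A u = 0 := by
  simp [bonferroniSum, expNegTrunc_zero]

/-- Split the sets by whether they contain `a`. The increment `-x a * bonferroniSum x (j - 1) A u`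
is `x a` times the `u`-derivative in `hasDerivAt_bonferroniSum`: to first order, an event acts like
Poisson mass. -/
theorem bonferroniSum_insert [DecidableEq α] (x : α → ℝ) (j : ℕ) {A : Finset α} {a : α} (ha : a ∉ A) (u : ℝ) :
    bonferroniSum x j (insert a A) u
      = bonferroniSum x j A u - x a * bonferroniSum x (j - 1) A u := by
  simp only [bonferroniSum]
  rw [Finset.sum_powerset_insert ha, Finset.mul_sum, sub_eq_add_neg, ← Finset.sum_neg_distrib]
  congr 1
  refine Finset.sum_congr rfl fun S hS => ?_
  have haS : a ∉ S := fun h => ha (Finset.mem_powerset.1 hS h)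
  rw [Finset.card_insert_of_notMem haS, Finset.prod_insert haS, pow_succ,
    show j - (S.card + 1) = j - 1 - S.card by omega]
  ring

theorem hasDerivAt_bonferroniSum (x : α → ℝ) (j : ℕ) (A : Finset α) (u : ℝ) :
    HasDerivAt (bonferroniSum x j A) (-bonferroniSum x (j - 1) A u) u := by
  have h := HasDerivAt.fun_sum (u := A.powerset) fun S _ =>
    (hasDerivAt_expNegTrunc (j - S.card) u).const_mul ((-1 : ℝ) ^ S.card * (∏ a ∈ S, x a))
  refine h.congr_deriv ?_
  rw [bonferroniSum, ← Finset.sum_neg_distrib]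
  refine Finset.sum_congr rfl fun S _ => ?_
  rw [show j - S.card - 1 = j - 1 - S.card by omega]
  ring

/-- Raising the truncation by one adds exactly the terms of total order `j`, all of sign `(-1) ^ j`.
-/
theorem bonferroniSum_succ_sub_sign [DecidableEq α] (x : α → ℝ) (A : Finset α) (hx : ∀ a ∈ A, 0 ≤ x a)
    {u : ℝ} (hu : 0 ≤ u) (j : ℕ) :
    0 ≤ (-1 : ℝ) ^ j * (bonferroniSum x (j + 1) A u - bonferroniSum x j A u) := by
  induction A using Finset.induction_on generalizing j with
  | empty =>
    rw [bonferroniSum_empty, bonferroniSum_empty, expNegTrunc_succ, add_sub_cancel_left, ← mul_assoc,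
      ← pow_add, Even.neg_one_pow ⟨j, rfl⟩]
    positivity
  | insert a A ha ih =>
    have ih := ih fun b hb => hx b (Finset.mem_insert_of_mem hb)
    have hxa := hx a (Finset.mem_insert_self a A)
    rw [bonferroniSum_insert _ _ ha, bonferroniSum_insert _ _ ha]
    cases j with
    | zero => simpa [bonferroniSum_zero] using ih 0
    | succ i =>
      simp only [Nat.add_sub_cancel]
      have h1 := ih (i + 1)
      have h2 := mul_nonneg hxa (ih i)
      rw [pow_succ] at h1 ⊢
      linarith

/-- Bonferroni's inequality. -/
theorem prod_mul_le_bonferroniSum [DecidableEq α] (x : α → ℝ) (A : Finset α) (hx : ∀ a ∈ A, x a ∈ Set.Icc (0 : ℝ) 1)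
    {u : ℝ} (hu : 0 ≤ u) (l : ℕ) :
    (∏ a ∈ A, (1 - x a)) * expNegTrunc (2 * l + 1) u ≤ bonferroniSum x (2 * l + 1) A u := by
  induction A using Finset.induction_on with
  | empty => simp [bonferroniSum_empty]
  | insert a A ha ih =>
    have hxA : ∀ b ∈ A, x b ∈ Set.Icc (0 : ℝ) 1 := fun b hb => hx b (Finset.mem_insert_of_mem hb)
    have hxa := hx a (Finset.mem_insert_self a A)
    rw [bonferroniSum_insert _ _ ha, Finset.prod_insert ha, Nat.add_sub_cancel]
    -- The order `2 * l` sum is at most the order `2 * l + 1` sum, so the insertion formula is at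
    -- least `(1 - x a)` times the latter.
    have h1 := bonferroniSum_succ_sub_sign x A (fun b hb => (hxA b hb).1) hu (2 * l)
    rw [Even.neg_one_pow (even_two_mul l), one_mul] at h1
    have h2 := mul_nonneg hxa.1 h1
    have h3 := mul_le_mul_of_nonneg_left (ih hxA) (sub_nonneg.2 hxa.2)
    linarith

theorem bonferroniSum_odd_nonneg [DecidableEq α] (x : α → ℝ) (A : Finset α)
    (hx : ∀ a ∈ A, x a ∈ Set.Icc (0 : ℝ) 1) {u : ℝ} (hu : u ∈ Set.Icc (0 : ℝ) 1) (l : ℕ) :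
    0 ≤ bonferroniSum x (2 * l + 1) A u :=
  le_trans (mul_nonneg (Finset.prod_nonneg fun a ha => sub_nonneg.2 (hx a ha).2)
    (expNegTrunc_mem_Icc _ hu).1) (prod_mul_le_bonferroniSum x A hx hu.1 l)

/-- Differentiating twice lowers the truncation by two, so the second derivative is again an odd
sum, hence nonnegative; for `l = 0` it is zero. -/
theorem convexOn_bonferroniSum [DecidableEq α] (x : α → ℝ) (A : Finset α)
    (hx : ∀ a ∈ A, x a ∈ Set.Icc (0 : ℝ) 1) (l : ℕ) :
    ConvexOn ℝ (Set.Icc 0 1) (bonferroniSum x (2 * l + 1) A) := by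
  refine convexOn_of_hasDerivWithinAt2_nonneg (convex_Icc 0 1)
    (f' := fun u => -bonferroniSum x (2 * l) A u)
    (f'' := fun u => bonferroniSum x (2 * l - 1) A u)
    (fun u _ => (hasDerivAt_bonferroniSum x _ A u).continuousAt.continuousWithinAt)
    (fun u _ => (hasDerivAt_bonferroniSum x _ A u).hasDerivWithinAt)
    (fun u _ => ?_) (fun u hu => ?_)
  · simpa using (hasDerivAt_bonferroniSum x (2 * l) A u).fun_neg.hasDerivWithinAt
  · cases l with
    | zero => simp [bonferroniSum_zero]
    | succ l => exact bonferroniSum_odd_nonneg x A hx (interior_subset hu) l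

/-- By the insertion formula, the left side is the tangent line at `u` evaluated at `u + x a`;
convexity puts it below the graph. -/
theorem bonferroniSum_insert_le [DecidableEq α] (x : α → ℝ) {A : Finset α} {a : α} (ha : a ∉ A)
    (hx : ∀ b ∈ A, x b ∈ Set.Icc (0 : ℝ) 1) (hxa : 0 ≤ x a) {u : ℝ} (hu : 0 ≤ u)
    (hu1 : u + x a ≤ 1) (l : ℕ) :
    bonferroniSum x (2 * l + 1) (insert a A) u ≤ bonferroniSum x (2 * l + 1) A (u + x a) := by
  rw [bonferroniSum_insert _ _ ha, Nat.add_sub_cancel]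
  rcases hxa.eq_or_lt with h0 | h0
  · simp [← h0]
  · have h := (convexOn_bonferroniSum x A hx l).le_slope_of_hasDerivAt (x := u) (y := u + x a)
      ⟨hu, by linarith⟩ ⟨by linarith, hu1⟩ (by linarith) (hasDerivAt_bonferroniSum x _ A u)
    rw [slope_def_field, add_sub_cancel_left, le_div_iff₀ h0] at h
    simp only [Nat.add_sub_cancel] at h
    linarith

theorem bonferroniSum_le_expNegTrunc [DecidableEq α] (x : α → ℝ) (A : Finset α) (hx : ∀ a ∈ A, 0 ≤ x a)
    {u : ℝ} (hu : 0 ≤ u) (hu1 : u + ∑ a ∈ A, x a ≤ 1) (l : ℕ) :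
    bonferroniSum x (2 * l + 1) A u ≤ expNegTrunc (2 * l + 1) (u + ∑ a ∈ A, x a) := by
  induction A using Finset.induction_on generalizing u with
  | empty => simp [bonferroniSum_empty]
  | insert a A ha ih =>
    have hxA : ∀ b ∈ A, 0 ≤ x b := fun b hb => hx b (Finset.mem_insert_of_mem hb)
    have hxa := hx a (Finset.mem_insert_self a A)
    rw [Finset.sum_insert ha, ← add_assoc] at hu1 ⊢
    have hs : ∀ b ∈ A, x b ≤ ∑ a ∈ A, x a := fun b hb => Finset.single_le_sum hxA hb
    refine (bonferroniSum_insert_le x ha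
      (fun b hb => ⟨hxA b hb, by linarith [hs b hb]⟩) hxa hu ?_ l).trans
      (ih hxA (by linarith) hu1)
    linarith [Finset.sum_nonneg hxA]

end Bonferroni

/-- A convex function lies below its chord over `[0, 1]`. Convexity is the Bonferroni one with no
events. -/
theorem phi_mul_le_one_sub_expNegTrunc (t : ℕ) {s : ℝ} (hs : s ∈ Set.Icc (0 : ℝ) 1) :
    phi t * s ≤ 1 - expNegTrunc (2 * (t / 2) + 1) s := by
  have hc := convexOn_bonferroniSum (α := ℕ) (fun _ => 0) ∅ (by simp) (t / 2)
  have h := hc.2 (x := 0) (y := 1) (by simp) (by simp) (sub_nonneg.2 hs.2) hs.1 (by ring)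
  simp only [bonferroniSum_empty, smul_eq_mul, mul_zero, zero_add, mul_one,
    expNegTrunc_succ_zero] at h
  rw [phi_eq]
  linarith

/-! ### Probabilities as finite sums -/

section PMF

variable {α β : Type*}

theorem prob_eq_sum [Fintype α] (D : PMF α) (A : Set α) :
    prob D A = ∑ a, (D a).toReal * A.indicator 1 a := by
  classical
  rw [prob, PMF.toOuterMeasure_apply_fintype, ENNReal.toReal_sum]
  · refine Finset.sum_congr rfl fun a _ => ?_
    by_cases h : a ∈ A <;> simp [h]
  · intro a _
    by_cases h : a ∈ A <;> simp [h, D.apply_ne_top]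

theorem prob_map (D : PMF α) (f : α → β) (A : Set β) : prob (D.map f) A = prob D (f ⁻¹' A) := by
  simp [prob, PMF.toOuterMeasure_map_apply]

theorem prob_bind [Fintype α] [Fintype β] (D : PMF α) (f : α → PMF β) (A : Set β) :
    prob (D.bind f) A = ∑ a, (D a).toReal * prob (f a) A := by
  rw [prob, PMF.toOuterMeasure_bind_apply, tsum_fintype, ENNReal.toReal_sum]
  · exact Finset.sum_congr rfl fun a _ => ENNReal.toReal_mul
  · intro a _
    refine ENNReal.mul_ne_top (D.apply_ne_top a) ?_
    classical
    rw [PMF.toOuterMeasure_apply_fintype]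
    refine (ENNReal.sum_lt_top.2 fun b _ => ?_).ne
    by_cases h : b ∈ A <;> simp [h, ((f a).apply_ne_top b).lt_top]

theorem sum_toReal_eq_one [Fintype α] (D : PMF α) : ∑ a, (D a).toReal = 1 := by
  rw [← ENNReal.toReal_sum fun a _ => D.apply_ne_top a, ← tsum_fintype (L := .unconditional α),
    D.tsum_coe, ENNReal.toReal_one]

theorem prob_nonneg (D : PMF α) (A : Set α) : 0 ≤ prob D A := ENNReal.toReal_nonneg

/-- A probability vector as a probability mass function. -/
def ofWeights [Fintype α] (w : α → ℝ) (h0 : ∀ a, 0 ≤ w a) (h1 : ∑ a, w a = 1) : PMF α :=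
  PMF.ofFintype (fun a => ENNReal.ofReal (w a)) (by
    rw [← ENNReal.ofReal_sum_of_nonneg fun a _ => h0 a, h1, ENNReal.ofReal_one])

theorem prob_ofWeights [Fintype α] (w : α → ℝ) (h0 : ∀ a, 0 ≤ w a) (h1 : ∑ a, w a = 1)
    (A : Set α) : prob (ofWeights w h0 h1) A = ∑ a, w a * A.indicator 1 a := by
  simp [prob_eq_sum, ofWeights, h0]

end PMF

/-! ### Duality between balanced schemes and hitting probabilities -/

variable {n : ℕ}

theorem SingleItemCRS.prob_jointLaw (π : SingleItemCRS n) (D : PMF (Finset (Fin n)))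
    (A : Set (Finset (Fin n) × Finset (Fin n))) :
    prob (π.jointLaw D) A = ∑ R, (D R).toReal * prob (π.select D R) {I | (R, I) ∈ A} := by
  simp only [jointLaw, prob_bind, prob_map]
  rfl

theorem SingleItemCRS.prob_jointLaw_fst (π : SingleItemCRS n) (D : PMF (Finset (Fin n)))
    (i : Fin n) : prob (π.jointLaw D) {p | i ∈ p.1} = marginal D i := by
  rw [prob_jointLaw, marginal, prob_eq_sum]
  refine Finset.sum_congr rfl fun R _ => ?_
  rw [prob_eq_sum]
  by_cases h : i ∈ R <;> simp [h, sum_toReal_eq_one]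

/-- A balanced scheme gives a lower bound on the probability that a given set is hit. -/
theorem SingleItemCRS.IsBalanced.mul_sum_marginal_le {π : SingleItemCRS n} {t : ℕ} {c : ℝ}
    (hπ : π.IsBalanced t c) {D : PMF (Finset (Fin n))} (hD : IsTwiseIndep t D)
    (hm : marginal D ∈ singleItemPolytope n) (A : Finset (Fin n)) :
    c * ∑ i ∈ A, marginal D i ≤ prob D {R | (R ∩ A).Nonempty} := by
  have key : ∀ i ∈ A, c * marginal D i ≤
      ∑ R, (D R).toReal * prob (π.select D R) {I | i ∈ I ∧ i ∈ R} := by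
    intro i _
    rcases (hm.1 i).eq_or_lt with h | h
    · rw [← h, mul_zero]
      exact Finset.sum_nonneg fun R _ => mul_nonneg ENNReal.toReal_nonneg (prob_nonneg _ _)
    · have := hπ D hD hm i h
      rw [condProb, prob_jointLaw_fst, le_div_iff₀ h, prob_jointLaw] at this
      exact this
  rw [Finset.mul_sum, prob_eq_sum]
  refine (Finset.sum_le_sum key).trans ?_
  rw [Finset.sum_comm]
  refine Finset.sum_le_sum fun R _ => ?_
  rw [← Finset.mul_sum]
  refine mul_le_mul_of_nonneg_left ?_ ENNReal.toReal_nonneg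
  simp only [prob_eq_sum]
  rw [Finset.sum_comm]
  refine (Finset.sum_le_sum (g := fun I => (π.select D R I).toReal *
    Set.indicator {R : Finset (Fin n) | (R ∩ A).Nonempty} 1 R) fun I _ => ?_).trans ?_
  · rw [← Finset.mul_sum]
    by_cases hI : I ∈ (π.select D R).support
    · refine mul_le_mul_of_nonneg_left ?_ ENNReal.toReal_nonneg
      have h1 := π.single D R I hI
      by_cases hR : (R ∩ A).Nonempty
      · simp only [Set.indicator_apply, Set.mem_ofPred_eq, hR, if_true, Pi.one_apply,
          Finset.sum_boole]
        refine le_trans (Nat.cast_le.2 (Finset.card_le_card (t := I) fun i hi => ?_))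
          (by exact_mod_cast h1)
        exact (Finset.mem_filter.1 hi).2.1
      · rw [Set.indicator_of_notMem (by simpa using hR)]
        refine (Finset.sum_eq_zero fun i hi => ?_).le
        refine Set.indicator_of_notMem (fun h => hR ⟨i, Finset.mem_inter.2 ⟨h.2, hi⟩⟩) _
    · rw [PMF.mem_support_iff, not_not] at hI
      simp [hI]
  · rw [← Finset.sum_mul, sum_toReal_eq_one, one_mul]

/-- Deterministic single-item selection rules. -/
abbrev SelectionRule (n : ℕ) : Type :=
  {s : Finset (Fin n) → Finset (Fin n) // ∀ R, s R ⊆ R ∧ (s R).card ≤ 1}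

/-- The vector of probabilities that the elements are selected by a deterministic rule. -/
def SelectionRule.value (s : SelectionRule n) (D : PMF (Finset (Fin n))) (i : Fin n) : ℝ :=
  prob D {R | i ∈ s.1 R}

open scoped NNReal in
-- The best single choice from `R` for weights `y`; positive parts appear because selecting nothing
-- is allowed.
theorem exists_subset_sum_eq_sup (y : Fin n → ℝ) (R : Finset (Fin n)) :
    ∃ I ⊆ R, I.card ≤ 1 ∧ ∑ i ∈ I, y i = (R.sup fun i => (y i).toNNReal : ℝ≥0) := by
  rcases R.eq_empty_or_nonempty with rfl | hR
  · exact ⟨∅, by simp⟩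
  · obtain ⟨i, hi, h⟩ := R.exists_mem_eq_sup hR fun i => (y i).toNNReal
    rw [h]
    rcases le_total 0 (y i) with h0 | h0
    · exact ⟨{i}, by simpa using hi, by simp, by simp [h0]⟩
    · exact ⟨∅, by simp, by simp, by simp [Real.toNNReal_of_nonpos h0]⟩

open scoped NNReal in
/-- Layer-cake step: hitting bounds for all sets give a bound on the expected maximum weight. -/
theorem mul_sum_le_expect_sup {x : Fin n → ℝ} {c : ℝ} (D : PMF (Finset (Fin n)))
    (h : ∀ A : Finset (Fin n), c * ∑ i ∈ A, x i ≤ prob D {R | (R ∩ A).Nonempty})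
    (y : Fin n → ℝ≥0) :
    c * ∑ i, x i * y i ≤ ∑ R, (D R).toReal * (R.sup y : ℝ≥0) := by
  induction hk : (Finset.univ.filter fun i => y i ≠ 0).card using Nat.strong_induction_on
    generalizing y with
  | _ k ih =>
    set A := Finset.univ.filter fun i => y i ≠ 0 with hA
    rcases A.eq_empty_or_nonempty with h0 | hne
    · have hy : ∀ i, y i = 0 := fun i => by
        by_contra hi
        have : i ∈ A := by simp [hA, hi]
        simp [h0] at this
      simp only [hy, NNReal.coe_zero, mul_zero, Finset.sum_const_zero]
      exact Finset.sum_nonneg fun R _ => mul_nonneg ENNReal.toReal_nonneg (NNReal.coe_nonneg _)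
    · obtain ⟨j, hj, hmin⟩ := A.exists_min_image y hne
      -- Peel off the lowest layer. Truncated subtraction keeps zero weights at zero and kills `y
      -- j`, so the support shrinks strictly.
      set z : Fin n → ℝ≥0 := fun i => y i - y j with hz
      have hyz : ∀ i ∈ A, y i = z i + y j := fun i hi => (tsub_add_cancel_of_le (hmin i hi)).symm
      have hzA : ∀ i ∉ A, z i = 0 ∧ y i = 0 := fun i hi => by
        have : y i = 0 := by simpa [hA] using hi
        simp [hz, this]
      have hz' := ih _ (by
        rw [← hk]
        refine Finset.card_lt_card (Finset.ssubset_iff_of_subset (fun i hi => ?_) |>.2 ⟨j, hj, ?_⟩)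
        · by_contra hi'
          exact (Finset.mem_filter.1 hi).2 (hzA i hi').1
        · simp [hz]) z rfl
      have e1 : ∑ i, x i * (y i : ℝ) = ∑ i, x i * (z i : ℝ) + (y j : ℝ) * ∑ i ∈ A, x i := by
        rw [Finset.mul_sum, ← Finset.sum_subset (Finset.subset_univ A)
          (f := fun i => x i * (y i : ℝ)), ← Finset.sum_subset (Finset.subset_univ A)
          (f := fun i => x i * (z i : ℝ)), ← Finset.sum_add_distrib]
        · refine Finset.sum_congr rfl fun i hi => ?_
          rw [hyz i hi, NNReal.coe_add]
          ring
        · intro i _ hi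
          simp [(hzA i hi).1]
        · intro i _ hi
          simp [(hzA i hi).2]
      have e2 : ∀ R : Finset (Fin n), ((R.sup z : ℝ≥0) : ℝ) +
          (y j : ℝ) * Set.indicator {R : Finset (Fin n) | (R ∩ A).Nonempty} 1 R
            ≤ (R.sup y : ℝ≥0) := by
        intro R
        by_cases hR : (R ∩ A).Nonempty
        · rw [Set.indicator_of_mem (by exact hR), Pi.one_apply, mul_one]
          have : R.sup z + y j ≤ R.sup y := by
            have hle : y j ≤ R.sup y := by
              obtain ⟨i, hi⟩ := hR
              exact (hmin i (Finset.mem_inter.1 hi).2).trans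
                (Finset.le_sup (f := y) (Finset.mem_inter.1 hi).1)
            rw [← le_tsub_iff_right hle]
            exact Finset.sup_le fun i hi => tsub_le_tsub_right (Finset.le_sup (f := y) hi) _
          exact_mod_cast this
        · rw [Set.indicator_of_notMem (by exact hR), mul_zero, add_zero, NNReal.coe_le_coe]
          exact Finset.sup_mono_fun fun i _ => tsub_le_self
      calc c * ∑ i, x i * (y i : ℝ)
          = c * ∑ i, x i * (z i : ℝ) + (y j : ℝ) * (c * ∑ i ∈ A, x i) := by rw [e1]; ring
        _ ≤ ∑ R, (D R).toReal * (R.sup z : ℝ≥0) +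
            (y j : ℝ) * prob D {R | (R ∩ A).Nonempty} :=
          add_le_add hz' (mul_le_mul_of_nonneg_left (h A) (NNReal.coe_nonneg _))
        _ = ∑ R, (D R).toReal * (((R.sup z : ℝ≥0) : ℝ) +
            (y j : ℝ) * Set.indicator {R : Finset (Fin n) | (R ∩ A).Nonempty} 1 R) := by
          rw [prob_eq_sum, Finset.mul_sum, ← Finset.sum_add_distrib]
          exact Finset.sum_congr rfl fun R _ => by ring
        _ ≤ _ := Finset.sum_le_sum fun R _ =>
          mul_le_mul_of_nonneg_left (e2 R) ENNReal.toReal_nonneg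

/-- Hitting bounds for all sets are sufficient for a random selection rule with prescribed
selection probabilities. -/
theorem exists_mixture_of_hitting {x : Fin n → ℝ} {c : ℝ} (D : PMF (Finset (Fin n)))
    (hc : 0 ≤ c) (hx : ∀ i, 0 ≤ x i)
    (h : ∀ A : Finset (Fin n), c * ∑ i ∈ A, x i ≤ prob D {R | (R ∩ A).Nonempty}) :
    ∃ w : PMF (SelectionRule n), ∀ i, ∑ s, (w s).toReal * s.value D i = c * x i := by
  classical
  let L : (SelectionRule n → ℝ) →ₗ[ℝ] (Fin n → ℝ) :=
    ∑ s, (LinearMap.proj s).smulRight (fun i => s.value D i)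
  have hL : ∀ w i, L w i = ∑ s, w s * s.value D i := fun w i => by
    simp [L, LinearMap.sum_apply, Finset.sum_apply]
  set K := L '' stdSimplex ℝ (SelectionRule n) with hK
  have hKc : Convex ℝ K := (convex_stdSimplex ℝ _).linear_image L
  have hKcl : IsClosed K :=
    ((isCompact_stdSimplex ℝ _).image L.continuous_of_finiteDimensional).isClosed
  by_cases hmem : (fun i => c * x i) ∈ K
  · obtain ⟨w, hw, hwx⟩ := hmem
    refine ⟨ofWeights w hw.1 hw.2, fun i => ?_⟩
    have := congrFun hwx i
    rw [hL] at this
    simpa [ofWeights, hw.1] using this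
  · exfalso
    -- Separate the target from the compact convex set of attainable selection vectors. The rule
    -- `σ`, greedy for the separating weights `y`, then contradicts the layer-cake bound.
    obtain ⟨f, u, hfu, huf⟩ := geometric_hahn_banach_closed_point hKc hKcl hmem
    set y : Fin n → ℝ := fun i => f (Pi.single i 1) with hy
    have hf : ∀ v, f v = ∑ i, v i * y i := fun v => by
      conv_lhs => rw [← Finset.univ_sum_single v, map_sum]
      refine Finset.sum_congr rfl fun i _ => ?_
      rw [show (Pi.single i (v i) : Fin n → ℝ) = v i • Pi.single i 1 by
        rw [← Pi.single_smul, smul_eq_mul, mul_one], map_smul, smul_eq_mul]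
    choose s hsR hs1 hsy using exists_subset_sum_eq_sup y
    let σ : SelectionRule n := ⟨s, fun R => ⟨hsR R, hs1 R⟩⟩
    have hσ : (fun i => σ.value D i) ∈ K :=
      ⟨Pi.single σ 1, single_mem_stdSimplex ℝ σ, funext fun i => by
        rw [hL, Finset.sum_eq_single σ] <;> simp +contextual⟩
    have h1 := (hfu _ hσ).trans huf
    rw [hf, hf] at h1
    have h2 : ∑ i, σ.value D i * y i
        = ∑ R, (D R).toReal * (R.sup fun i => (y i).toNNReal : NNReal) := by
      simp only [← hsy, SelectionRule.value, prob_eq_sum, Finset.sum_mul]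
      rw [Finset.sum_comm]
      refine Finset.sum_congr rfl fun R _ => ?_
      simp only [mul_assoc]
      rw [← Finset.mul_sum]
      congr 1
      simp [Set.indicator_apply, σ]
    have h3 := mul_sum_le_expect_sup D h fun i => (y i).toNNReal
    have h4 : ∑ i, c * x i * y i ≤ c * ∑ i, x i * ((y i).toNNReal : ℝ) := by
      rw [Finset.mul_sum]
      refine Finset.sum_le_sum fun i _ => ?_
      rw [mul_assoc]
      exact mul_le_mul_of_nonneg_left
        (mul_le_mul_of_nonneg_left (Real.le_coe_toNNReal _) (hx i)) hc
    linarith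

/-- The scheme that draws a deterministic rule from a mixture depending on the distribution. -/
def ofMixture (w : PMF (Finset (Fin n)) → PMF (SelectionRule n)) : SingleItemCRS n where
  select D R := (w D).map fun s => s.1 R
  subset D R I hI := by
    obtain ⟨s, -, rfl⟩ := (PMF.mem_support_map_iff _ _ _).1 hI
    exact (s.2 R).1
  single D R I hI := by
    obtain ⟨s, -, rfl⟩ := (PMF.mem_support_map_iff _ _ _).1 hI
    exact (s.2 R).2

theorem prob_jointLaw_ofMixture (w : PMF (Finset (Fin n)) → PMF (SelectionRule n))
    (D : PMF (Finset (Fin n))) (i : Fin n) :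
    prob ((ofMixture w).jointLaw D) ({p | i ∈ p.2} ∩ {p | i ∈ p.1})
      = ∑ s, (w D s).toReal * s.value D i := by
  classical
  rw [SingleItemCRS.prob_jointLaw]
  simp only [ofMixture, prob_map]
  simp only [SelectionRule.value, prob_eq_sum, Finset.mul_sum]
  rw [Finset.sum_comm]
  refine Finset.sum_congr rfl fun s _ => Finset.sum_congr rfl fun R _ => ?_
  rw [mul_left_comm]
  congr 2
  refine Set.indicator_eq_indicator ?_ rfl
  simp only [Set.mem_preimage, Set.mem_ofPred_eq, Set.mem_inter_iff]
  exact ⟨fun h => h.1, fun h => ⟨h, (s.2 R).1 h⟩⟩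

/-- Balancedness `c` is achievable iff every set `A` is hit with probability at least `c` times the
sum of its marginals, for all `t`-wise independent distributions. -/
theorem mem_achievable_iff {t : ℕ} {c : ℝ} :
    c ∈ achievable t n ↔ c ∈ Set.Icc (0 : ℝ) 1 ∧
      ∀ D : PMF (Finset (Fin n)), IsTwiseIndep t D → marginal D ∈ singleItemPolytope n →
        ∀ A : Finset (Fin n), c * ∑ i ∈ A, marginal D i ≤ prob D {R | (R ∩ A).Nonempty} := by
  refine ⟨fun ⟨hc, π, hπ⟩ => ⟨hc, fun D hD hm A => hπ.mul_sum_marginal_le hD hm A⟩,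
    fun ⟨hc, h⟩ => ⟨hc, ?_⟩⟩
  have hw : ∀ D : PMF (Finset (Fin n)), ∃ w : PMF (SelectionRule n), IsTwiseIndep t D →
      marginal D ∈ singleItemPolytope n →
        ∀ i, ∑ s, (w s).toReal * s.value D i = c * marginal D i := by
    intro D
    by_cases hD : IsTwiseIndep t D ∧ marginal D ∈ singleItemPolytope n
    · obtain ⟨w, hw⟩ := exists_mixture_of_hitting D hc.1 hD.2.1 (h D hD.1 hD.2)
      exact ⟨w, fun _ _ => hw⟩
    · exact ⟨PMF.pure ⟨fun _ => ∅, by simp⟩, fun h1 h2 => absurd ⟨h1, h2⟩ hD⟩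
  choose w hw using hw
  refine ⟨ofMixture w, fun D hD hm i hi => ?_⟩
  rw [condProb, SingleItemCRS.prob_jointLaw_fst, prob_jointLaw_ofMixture, hw D hD hm i,
    mul_div_cancel_right₀ _ hi.ne']

theorem isClosed_achievable (t n : ℕ) : IsClosed (achievable t n) := by
  have : achievable t n = Set.Icc (0 : ℝ) 1 ∩ ⋂ (D : PMF (Finset (Fin n))) (_ : IsTwiseIndep t D)
      (_ : marginal D ∈ singleItemPolytope n) (A : Finset (Fin n)),
      {c : ℝ | c * ∑ i ∈ A, marginal D i ≤ prob D {R | (R ∩ A).Nonempty}} := by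
    ext c
    simp only [mem_achievable_iff, Set.mem_inter_iff, Set.mem_iInter, Set.mem_ofPred_eq]
  rw [this]
  exact isClosed_Icc.inter (isClosed_iInter fun D => isClosed_iInter fun _ => isClosed_iInter
    fun _ => isClosed_iInter fun A => isClosed_le (by fun_prop) continuous_const)

/-! ### Lower bound -/

/-- Bonferroni's inequality for the event that a `t`-wise independent random set misses `A`. -/
theorem one_sub_bonferroniSum_le_prob_hit {t j : ℕ} {l : ℕ} (hj : j = 2 * l + 1) (hjt : j ≤ t + 1)
    {D : PMF (Finset (Fin n))} (hD : IsTwiseIndep t D) (A : Finset (Fin n)) :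
    1 - bonferroniSum (marginal D) j A 0 ≤ prob D {R | (R ∩ A).Nonempty} := by
  subst hj
  -- For fixed `R` the events are deterministic, with probabilities 0 or 1. Bonferroni is applied to
  -- each `R` and averaged; independence identifies the average, since only sets of size at most `2
  -- * l ≤ t` contribute.
  set v : Finset (Fin n) → Fin n → ℝ := fun R i => if i ∈ R then 1 else 0 with hv
  have hprod : ∀ R S : Finset (Fin n),
      ∏ i ∈ S, v R i = Set.indicator {R : Finset (Fin n) | S ⊆ R} 1 R := fun R S => by
    by_cases h : S ⊆ R
    · rw [Set.indicator_of_mem (by exact h)]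
      exact Finset.prod_eq_one fun i hi => if_pos (h hi)
    · rw [Set.indicator_of_notMem (by exact h)]
      obtain ⟨i, hi, hiR⟩ := Finset.not_subset.1 h
      exact Finset.prod_eq_zero hi (if_neg hiR)
  have hE : bonferroniSum (marginal D) (2 * l + 1) A 0
      = ∑ R, (D R).toReal * bonferroniSum (v R) (2 * l + 1) A 0 := by
    simp only [bonferroniSum, Finset.mul_sum]
    rw [Finset.sum_comm]
    refine Finset.sum_congr rfl fun S _ => ?_
    rcases le_or_gt S.card t with hS | hS
    · rw [← hD S hS, prob_eq_sum, Finset.mul_sum, Finset.sum_mul]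
      refine Finset.sum_congr rfl fun R _ => ?_
      rw [hprod]
      ring
    · simp [show 2 * l + 1 - S.card = 0 by omega, expNegTrunc_zero]
  have hpt : ∀ R : Finset (Fin n), 1 - bonferroniSum (v R) (2 * l + 1) A 0
      ≤ Set.indicator {R : Finset (Fin n) | (R ∩ A).Nonempty} 1 R := fun R => by
    have h := prod_mul_le_bonferroniSum (v R) A (u := 0)
      (fun i _ => by by_cases hi : i ∈ R <;> simp [hv, hi]) le_rfl l
    rw [expNegTrunc_succ_zero, mul_one] at h
    have h0 : 0 ≤ ∏ i ∈ A, (1 - v R i) :=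
      Finset.prod_nonneg fun i _ => by by_cases hi : i ∈ R <;> simp [hv, hi]
    by_cases hR : (R ∩ A).Nonempty
    · rw [Set.indicator_of_mem (by exact hR), Pi.one_apply]
      linarith
    · rw [Set.indicator_of_notMem (by exact hR)]
      have : ∏ i ∈ A, (1 - v R i) = 1 := Finset.prod_eq_one fun i hi => by
        have : i ∉ R := fun h => hR ⟨i, Finset.mem_inter.2 ⟨h, hi⟩⟩
        simp [hv, this]
      linarith
  rw [hE, ← sum_toReal_eq_one D, ← Finset.sum_sub_distrib, prob_eq_sum]
  refine Finset.sum_le_sum fun R _ => ?_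
  have := mul_le_mul_of_nonneg_left (hpt R) (ENNReal.toReal_nonneg (a := D R))
  linarith

theorem phi_mem_achievable (t n : ℕ) : phi t ∈ achievable t n := by
  refine mem_achievable_iff.2 ⟨phi_mem_Icc t, fun D hD hm A => ?_⟩
  have h1 : ∑ i ∈ A, marginal D i ≤ 1 :=
    (Finset.sum_le_sum_of_subset_of_nonneg (Finset.subset_univ A) fun i _ _ => hm.1 i).trans hm.2
  have h2 := bonferroniSum_le_expNegTrunc (marginal D) A (fun i _ => hm.1 i) le_rfl
    (by rwa [zero_add]) (t / 2)
  rw [zero_add] at h2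
  have h3 := phi_mul_le_one_sub_expNegTrunc t ⟨Finset.sum_nonneg fun i _ => hm.1 i, h1⟩
  have h4 := one_sub_bonferroniSum_le_prob_hit rfl (by omega) (l := t / 2) hD A
  linarith

/-! ### Extremal distribution by Möbius inversion, and the upper bound -/

section Extremal

/-- Truncated moments of the extremal distribution. -/
def truncMoment (n m k : ℕ) : ℝ :=
  if k ≤ m then (n : ℝ)⁻¹ ^ k - (n : ℝ)⁻¹ ^ (m + 1) else 0

theorem truncMoment_nonneg (hn : 1 ≤ n) (m k : ℕ) : 0 ≤ truncMoment n m k := by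
  unfold truncMoment
  split_ifs with h
  · exact sub_nonneg.2 (pow_le_pow_of_le_one (by positivity)
      (inv_le_one_of_one_le₀ (by exact_mod_cast hn)) (by omega))
  · rfl

theorem mul_truncMoment_succ_le (hn : 1 ≤ n) (m k : ℕ) :
    n * truncMoment n m (k + 1) ≤ truncMoment n m k := by
  by_cases h : k + 1 ≤ m
  · have hn0 : (n : ℝ) ≠ 0 := by positivity
    have hp : (n : ℝ)⁻¹ ^ (m + 1) ≤ (n : ℝ)⁻¹ ^ m := pow_le_pow_of_le_one (by positivity)
      (inv_le_one_of_one_le₀ (by exact_mod_cast hn)) (by omega)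
    have e : ∀ k : ℕ, (n : ℝ) * (n : ℝ)⁻¹ ^ (k + 1) = (n : ℝ)⁻¹ ^ k := fun k => by
      rw [pow_succ', mul_inv_cancel_left₀ hn0]
    rw [truncMoment, truncMoment, if_pos h, if_pos (by omega), mul_sub, e, e]
    linarith
  · rw [truncMoment, if_neg h, mul_zero]
    exact truncMoment_nonneg hn m k

/-- Binomial coefficients grow by a factor of at most `n` per step and the moments shrink by at
least `n`. So the Möbius sum alternates with nonincreasing terms, which makes the weights
nonnegative. -/
theorem choose_succ_mul_truncMoment_le (hn : 1 ≤ n) {N : ℕ} (hN : N ≤ n) (m j i : ℕ) :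
    (N.choose (i + 1) : ℝ) * truncMoment n m (j + (i + 1))
      ≤ (N.choose i : ℝ) * truncMoment n m (j + i) := by
  have h1 : N.choose (i + 1) ≤ N.choose i * n :=
    calc N.choose (i + 1) ≤ N.choose (i + 1) * (i + 1) := Nat.le_mul_of_pos_right _ i.succ_pos
      _ = N.choose i * (N - i) := Nat.choose_succ_right_eq N i
      _ ≤ N.choose i * n := Nat.mul_le_mul_left _ (by omega)
  calc (N.choose (i + 1) : ℝ) * truncMoment n m (j + (i + 1))
      ≤ (N.choose i * n : ℝ) * truncMoment n m (j + (i + 1)) :=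
        mul_le_mul_of_nonneg_right (by exact_mod_cast h1) (truncMoment_nonneg hn _ _)
    _ = N.choose i * (n * truncMoment n m (j + i + 1)) := by rw [mul_assoc, ← add_assoc]
    _ ≤ _ := mul_le_mul_of_nonneg_left (mul_truncMoment_succ_le hn m _) (Nat.cast_nonneg _)

theorem sum_Icc_eq_sum_powerset_sdiff {α : Type*} [DecidableEq α]
    {U V : Finset α} (h : U ⊆ V) (f : Finset α → ℝ) :
    ∑ R ∈ Finset.Icc U V, f R = ∑ W ∈ (V \ U).powerset, f (U ∪ W) := by
  rw [Finset.Icc_eq_image_powerset h, Finset.sum_image]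
  intro W hW W' hW' e
  have d : ∀ W ∈ (V \ U).powerset, (U ∪ W) \ U = W := fun W hW =>
    Finset.union_sdiff_cancel_left
      (Finset.disjoint_of_subset_right (Finset.mem_powerset.1 hW) Finset.disjoint_sdiff)
  rw [← d W hW, ← d W' hW']
  exact congrArg (· \ U) e

theorem card_union_of_mem_powerset_sdiff {α : Type*} [DecidableEq α] {U V W : Finset α}
    (hW : W ∈ (V \ U).powerset) : (U ∪ W).card = U.card + W.card :=
  Finset.card_union_of_disjoint
    (Finset.disjoint_of_subset_right (Finset.mem_powerset.1 hW) Finset.disjoint_sdiff)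

theorem sum_Icc_neg_one_pow_card {α : Type*} [DecidableEq α] {U V : Finset α} (h : U ⊆ V) :
    ∑ R ∈ Finset.Icc U V, (-1 : ℝ) ^ (V.card + R.card) = if V = U then 1 else 0 := by
  rw [sum_Icc_eq_sum_powerset_sdiff h]
  have e : ∑ W ∈ (V \ U).powerset, (-1 : ℝ) ^ (V.card + (U ∪ W).card)
      = (-1) ^ (V.card + U.card) * ∑ W ∈ (V \ U).powerset, (-1 : ℝ) ^ W.card := by
    rw [Finset.mul_sum]
    refine Finset.sum_congr rfl fun W hW => ?_
    rw [card_union_of_mem_powerset_sdiff hW, ← pow_add, add_assoc]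
  have z : ∑ W ∈ (V \ U).powerset, (-1 : ℝ) ^ W.card = if V \ U = ∅ then 1 else 0 := by
    exact_mod_cast congrArg (Int.cast (R := ℝ)) (Finset.sum_powerset_neg_one_pow_card (x := V \ U))
  rw [e, z]
  by_cases hUV : V = U
  · subst hUV
    simp
  · rw [if_neg hUV, if_neg, mul_zero]
    exact fun h0 => hUV (Finset.Subset.antisymm (Finset.sdiff_eq_empty_iff_subset.1 h0) h)

/-- Möbius inverse of the truncated moments. -/
def moebiusWeight (n m : ℕ) (U : Finset (Fin n)) : ℝ :=
  ∑ V ∈ Finset.Icc U Finset.univ, (-1 : ℝ) ^ (V.card + U.card) * truncMoment n m V.card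

theorem moebiusWeight_eq (m : ℕ) (U : Finset (Fin n)) :
    moebiusWeight n m U = ∑ i ∈ Finset.range ((Finset.univ \ U).card + 1),
      (-1 : ℝ) ^ i * (((Finset.univ \ U).card.choose i : ℝ) * truncMoment n m (U.card + i)) := by
  rw [moebiusWeight, sum_Icc_eq_sum_powerset_sdiff (Finset.subset_univ U)]
  rw [Finset.sum_congr rfl fun W hW => show _ =
    (fun i => (-1 : ℝ) ^ i * truncMoment n m (U.card + i)) W.card by
      rw [card_union_of_mem_powerset_sdiff hW, add_right_comm, pow_add,
        Even.neg_one_pow ⟨U.card, rfl⟩, one_mul]]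
  rw [Finset.sum_powerset_apply_card fun i => (-1 : ℝ) ^ i * truncMoment n m (U.card + i)]
  refine Finset.sum_congr rfl fun i _ => ?_
  rw [nsmul_eq_mul]
  ring

theorem moebiusWeight_nonneg (hn : 1 ≤ n) (m : ℕ) (U : Finset (Fin n)) :
    0 ≤ moebiusWeight n m U := by
  rw [moebiusWeight_eq]
  have hN : (Finset.univ \ U).card ≤ n := by
    simpa using Finset.card_le_univ (Finset.univ \ U)
  exact (alternating_sum_mem_Icc _ _
    (fun i => mul_nonneg (Nat.cast_nonneg _) (truncMoment_nonneg hn _ _))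
    (fun i => choose_succ_mul_truncMoment_le hn hN m _ i)).1

/-- Möbius inversion: after exchanging the sums, the inner alternating sum over `[S, V]` vanishes
unless `V = S`. -/
theorem sum_Icc_moebiusWeight (m : ℕ) (S : Finset (Fin n)) :
    ∑ R ∈ Finset.Icc S Finset.univ, moebiusWeight n m R = truncMoment n m S.card := by
  simp only [moebiusWeight]
  rw [Finset.sum_comm' (t' := Finset.Icc S Finset.univ) (s' := fun V => Finset.Icc S V)]
  · rw [Finset.sum_eq_single S]
    · rw [← Finset.sum_mul, sum_Icc_neg_one_pow_card subset_rfl, if_pos rfl, one_mul]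
    · intro V hV hVS
      rw [← Finset.sum_mul, sum_Icc_neg_one_pow_card (Finset.mem_Icc.1 hV).1, if_neg hVS, zero_mul]
    · intro h
      simp at h
  · intro R V
    simp only [Finset.mem_Icc, Finset.subset_univ, and_true]
    exact ⟨fun h => ⟨⟨h.1, h.2⟩, h.1.trans h.2⟩, fun h => h.1⟩

/-- Point probabilities of the extremal distribution: at most `m` active elements, or all. -/
def extremalWeight (n m : ℕ) (U : Finset (Fin n)) : ℝ :=
  moebiusWeight n m U + if U = Finset.univ then (n : ℝ)⁻¹ ^ (m + 1) else 0

theorem extremalWeight_nonneg (hn : 1 ≤ n) (m : ℕ) (U : Finset (Fin n)) :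
    0 ≤ extremalWeight n m U := by
  refine add_nonneg (moebiusWeight_nonneg hn m U) ?_
  split_ifs <;> positivity

theorem sum_Icc_extremalWeight {m : ℕ} {S : Finset (Fin n)} (hS : S.card ≤ m + 1) :
    ∑ R ∈ Finset.Icc S Finset.univ, extremalWeight n m R = (n : ℝ)⁻¹ ^ S.card := by
  simp only [extremalWeight]
  rw [Finset.sum_add_distrib, sum_Icc_moebiusWeight, Finset.sum_ite_eq' _ _ fun _ => _,
    if_pos (by simp), truncMoment]
  -- The atom at the full set restores the subtracted `n⁻¹ ^ (m + 1)`. At size `m + 1` it is the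
  -- whole moment, which gives the extra order of independence needed for odd `t`.
  split_ifs with h
  · ring
  · rw [show S.card = m + 1 by omega, zero_add]

theorem sum_extremalWeight (n m : ℕ) : ∑ R, extremalWeight n m R = 1 := by
  have := sum_Icc_extremalWeight (n := n) (m := m) (S := ∅) (by simp)
  rw [Finset.card_empty, pow_zero] at this
  rw [← this]
  refine Finset.sum_congr (by ext; simp) fun _ _ => rfl

/-- An `(m+1)`-wise independent random set with marginals `1/n` that is empty with nearly the
largest possible probability. -/
def extremal (hn : 1 ≤ n) (m : ℕ) : PMF (Finset (Fin n)) :=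
  ofWeights (extremalWeight n m) (extremalWeight_nonneg hn m) (sum_extremalWeight n m)

theorem prob_extremal_superset (hn : 1 ≤ n) {m : ℕ} {S : Finset (Fin n)} (hS : S.card ≤ m + 1) :
    prob (extremal hn m) {R | S ⊆ R} = (n : ℝ)⁻¹ ^ S.card := by
  classical
  rw [extremal, prob_ofWeights, ← sum_Icc_extremalWeight hS]
  rw [← Finset.sum_subset (Finset.subset_univ (Finset.Icc S Finset.univ))]
  · refine Finset.sum_congr rfl fun R hR => ?_
    rw [Set.indicator_of_mem (by exact (Finset.mem_Icc.1 hR).1), Pi.one_apply, mul_one]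
  · intro R _ hR
    rw [Set.indicator_of_notMem (by simpa using hR), mul_zero]

theorem marginal_extremal (hn : 1 ≤ n) (m : ℕ) (i : Fin n) :
    marginal (extremal hn m) i = (n : ℝ)⁻¹ := by
  simpa [marginal] using prob_extremal_superset hn (m := m) (S := {i}) (by simp)

theorem isTwiseIndep_extremal (hn : 1 ≤ n) {m t : ℕ} (ht : t ≤ m + 1) :
    IsTwiseIndep t (extremal hn m) := fun S hS => by
  simp [prob_extremal_superset hn (hS.trans ht), marginal_extremal]

theorem sum_marginal_extremal (hn : 1 ≤ n) (m : ℕ) : ∑ i, marginal (extremal hn m) i = 1 := by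
  have : (n : ℝ) ≠ 0 := by positivity
  simp [marginal_extremal, this]

theorem prob_extremal_nonempty (hn : 1 ≤ n) (m : ℕ) :
    prob (extremal hn m) {R | R.Nonempty} = 1 - extremalWeight n m ∅ := by
  classical
  rw [extremal, prob_ofWeights, ← sum_extremalWeight n m, eq_sub_iff_add_eq,
    ← Finset.sum_erase_add _ _ (Finset.mem_univ (∅ : Finset (Fin n))),
    ← Finset.sum_erase_add _ (extremalWeight n m) (Finset.mem_univ (∅ : Finset (Fin n))),
    Set.indicator_of_notMem (by simp), mul_zero, add_zero]
  congr 1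
  refine Finset.sum_congr rfl fun R hR => ?_
  rw [Set.indicator_of_mem (by exact Finset.nonempty_iff_ne_empty.2 (Finset.ne_of_mem_erase hR)),
    Pi.one_apply, mul_one]

theorem extremalWeight_empty (hn : 1 ≤ n) (m : ℕ) :
    extremalWeight n m ∅ = ∑ k ∈ Finset.range (m + 1),
      (-1 : ℝ) ^ k * ((n.choose k : ℝ) * ((n : ℝ)⁻¹ ^ k - (n : ℝ)⁻¹ ^ (m + 1))) := by
  have : NeZero n := ⟨by omega⟩
  -- Since `n ≥ 1`, the atom at the full set does not charge `∅`.
  have hne : (∅ : Finset (Fin n)) ≠ Finset.univ := Finset.univ_nonempty.ne_empty.symm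
  rw [extremalWeight, if_neg hne, add_zero, moebiusWeight_eq]
  simp only [Finset.sdiff_empty, Finset.card_univ, Fintype.card_fin, Finset.card_empty, zero_add]
  have e1 : ∀ N, n ≤ N → ∑ k ∈ Finset.range (n + 1),
      (-1 : ℝ) ^ k * ((n.choose k : ℝ) * truncMoment n m k)
        = ∑ k ∈ Finset.range (N + 1), (-1 : ℝ) ^ k * ((n.choose k : ℝ) * truncMoment n m k) := by
    intro N hN
    refine Finset.sum_subset (Finset.range_mono (by omega)) fun k _ hk => ?_
    rw [Nat.choose_eq_zero_of_lt (by simpa using hk)]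
    simp
  -- Both ranges extend to `max n m`: binomials vanish beyond `n`, truncated moments beyond `m`.
  rw [e1 (max n m) (le_max_left _ _)]
  symm
  refine (Finset.sum_congr rfl fun k hk => ?_).trans
    (Finset.sum_subset (Finset.range_mono (Nat.succ_le_succ (le_max_right n m))) fun k _ hk => ?_)
  · rw [truncMoment, if_pos (by simpa [Nat.lt_succ_iff] using hk)]
  · rw [truncMoment, if_neg (by simpa using hk)]
    simp

theorem choose_mul_inv_pow_le (hn : 1 ≤ n) (k : ℕ) :
    (n.choose k : ℝ) * (n : ℝ)⁻¹ ^ k ≤ 1 / (k.factorial : ℝ) := by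
  have := Nat.choose_le_pow_div (α := ℝ) k n
  have hp : (0 : ℝ) < (n : ℝ) ^ k := by positivity
  rw [inv_pow, ← div_eq_mul_inv, div_le_iff₀ hp]
  calc (n.choose k : ℝ) ≤ _ := this
    _ = _ := by ring

/-- For `k ≤ n` this is Bernoulli's inequality for `(1 - k / n) ^ k`; for `k > n` the left side is
nonpositive. -/
theorem one_div_factorial_sub_le_choose_mul (hn : 1 ≤ n) (k : ℕ) :
    1 / (k.factorial : ℝ) - (k : ℝ) ^ 2 / n ≤ (n.choose k : ℝ) * (n : ℝ)⁻¹ ^ k := by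
  have hn0 : (0 : ℝ) < n := by positivity
  have hf1 : (1 : ℝ) ≤ k.factorial := by exact_mod_cast k.factorial_pos
  have hf : 1 / (k.factorial : ℝ) ≤ 1 := by
    rw [div_le_one (by positivity)]
    exact hf1
  rcases le_or_gt k n with hk | hk
  · have h1 : ((n : ℝ) - k) ^ k ≤ (k.factorial : ℝ) * n.choose k := by
      have := (Nat.pow_le_pow_left (show n - k ≤ n + 1 - k by omega) k).trans
        (Nat.pow_sub_le_descFactorial n k)
      rw [Nat.descFactorial_eq_factorial_mul_choose] at this
      rw [← Nat.cast_sub hk]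
      exact_mod_cast this
    have h2 : 1 - (k : ℝ) ^ 2 / n ≤ ((n : ℝ) - k) ^ k * (n : ℝ)⁻¹ ^ k := by
      have hkn : (k : ℝ) / n ≤ 1 := by
        rw [div_le_one hn0]
        exact_mod_cast hk
      have := one_add_mul_le_pow (a := -((k : ℝ) / n)) (by linarith) k
      rw [← mul_pow, show ((n : ℝ) - k) * (n : ℝ)⁻¹ = 1 + -((k : ℝ) / n) by field_simp; ring]
      refine le_trans (le_of_eq ?_) this
      ring
    have h3 : 1 / (k.factorial : ℝ) * (1 - (k : ℝ) ^ 2 / n)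
        ≤ (n.choose k : ℝ) * (n : ℝ)⁻¹ ^ k := by
      rw [one_div, inv_mul_le_iff₀ (by positivity)]
      refine h2.trans ?_
      rw [← mul_assoc]
      exact mul_le_mul_of_nonneg_right h1 (by positivity)
    have h4 : 1 / (k.factorial : ℝ) * ((k : ℝ) ^ 2 / n) ≤ (k : ℝ) ^ 2 / n :=
      mul_le_of_le_one_left (by positivity) hf
    linarith
  · have : (1 : ℝ) ≤ (k : ℝ) ^ 2 / n := by
      rw [one_le_div hn0]
      have : (n : ℝ) ≤ k := by exact_mod_cast hk.le
      have h1 : (1 : ℝ) ≤ n := by exact_mod_cast hn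
      nlinarith
    have h0 : (0 : ℝ) ≤ (n.choose k : ℝ) * (n : ℝ)⁻¹ ^ k := by positivity
    linarith

theorem choose_mul_inv_pow_succ_le (hn : 1 ≤ n) {k m : ℕ} (hk : k ≤ m) :
    (n.choose k : ℝ) * (n : ℝ)⁻¹ ^ (m + 1) ≤ 1 / n := by
  have h1 : (n : ℝ)⁻¹ ^ (m + 1) ≤ (n : ℝ)⁻¹ ^ (k + 1) := pow_le_pow_of_le_one (by positivity)
      (inv_le_one_of_one_le₀ (by exact_mod_cast hn)) (by omega)
  have h2 : (n.choose k : ℝ) * (n : ℝ)⁻¹ ^ k ≤ 1 := by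
    refine (choose_mul_inv_pow_le hn k).trans ?_
    rw [div_le_one (by positivity)]
    exact_mod_cast k.factorial_pos
  calc (n.choose k : ℝ) * (n : ℝ)⁻¹ ^ (m + 1) ≤ (n.choose k : ℝ) * (n : ℝ)⁻¹ ^ (k + 1) := by gcongr
    _ = ((n.choose k : ℝ) * (n : ℝ)⁻¹ ^ k) * (1 / n) := by ring
    _ ≤ 1 * (1 / n) := mul_le_mul_of_nonneg_right h2 (by positivity)
    _ = 1 / n := one_mul _

/-- Each of the `m + 1` terms errs by at most `m ^ 2 / n` from the binomial coefficient plus `1 / n`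
from the subtracted `n⁻¹ ^ (m + 1)`. -/
theorem expNegTrunc_sub_le_extremalWeight_empty (hn : 1 ≤ n) (m : ℕ) :
    expNegTrunc (m + 1) 1 - (m + 1) * ((m : ℝ) ^ 2 + 1) / n ≤ extremalWeight n m ∅ := by
  rw [extremalWeight_empty hn, sub_le_iff_le_add, ← sub_le_iff_le_add', expNegTrunc,
    ← Finset.sum_sub_distrib]
  have hn0 : (0 : ℝ) < n := by positivity
  have key : ∀ k ∈ Finset.range (m + 1), (-1 : ℝ) ^ k * ((1 : ℝ) ^ k / (k.factorial : ℝ)) -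
      (-1 : ℝ) ^ k * ((n.choose k : ℝ) * ((n : ℝ)⁻¹ ^ k - (n : ℝ)⁻¹ ^ (m + 1)))
        ≤ ((m : ℝ) ^ 2 + 1) / n := by
    intro k hk
    have hkm : k ≤ m := Nat.lt_succ_iff.1 (Finset.mem_range.1 hk)
    have h1 := choose_mul_inv_pow_le hn k
    have h2 := one_div_factorial_sub_le_choose_mul hn k
    have h3 := choose_mul_inv_pow_succ_le hn hkm
    have h3' : (0 : ℝ) ≤ (n.choose k : ℝ) * (n : ℝ)⁻¹ ^ (m + 1) := by positivity
    have h4 : (k : ℝ) ^ 2 / n ≤ (m : ℝ) ^ 2 / n := by gcongr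
    have h5 : (0 : ℝ) ≤ (m : ℝ) ^ 2 / n := by positivity
    rw [one_pow, add_div, mul_sub]
    rcases neg_one_pow_eq_or ℝ k with e | e <;> rw [e] <;> linarith
  refine (Finset.sum_le_card_nsmul _ _ _ key).trans (le_of_eq ?_)
  rw [Finset.card_range, nsmul_eq_mul]
  push_cast
  ring

end Extremal

theorem le_phi_add_of_mem_achievable {t : ℕ} (hn : 1 ≤ n) {c : ℝ} (hc : c ∈ achievable t n) :
    c ≤ phi t + ((2 * (t / 2) : ℕ) + 1) * (((2 * (t / 2) : ℕ) : ℝ) ^ 2 + 1) / n := by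
  set m := 2 * (t / 2) with hm
  have hs := sum_marginal_extremal hn m
  have h := (mem_achievable_iff.1 hc).2 (extremal hn m) (isTwiseIndep_extremal hn (by omega))
    ⟨fun i => by rw [marginal_extremal]; positivity, hs.le⟩ Finset.univ
  simp only [hs, mul_one, Finset.inter_univ, prob_extremal_nonempty] at h
  have h1 := expNegTrunc_sub_le_extremalWeight_empty hn m
  rw [phi_eq]
  linarith

end TwiseCRS

end

theorem theorem1p5 (t : ℕ) (ht : 1 ≤ t) :
    ∃ C : ℝ, ∀ n : ℕ, 1 ≤ n →
      ∃ c : ℝ, IsGreatest (TwiseCRS.achievable t n) c ∧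
        TwiseCRS.phi t ≤ c ∧ c ≤ TwiseCRS.phi t + C / (n : ℝ) := by
  refine ⟨((2 * (t / 2) : ℕ) + 1) * (((2 * (t / 2) : ℕ) : ℝ) ^ 2 + 1), fun n hn => ?_⟩
  have hcpt : IsCompact (TwiseCRS.achievable t n) :=
    isCompact_Icc.of_isClosed_subset (TwiseCRS.isClosed_achievable t n) fun c hc => hc.1
  have hphi := TwiseCRS.phi_mem_achievable t n
  obtain ⟨c, hc⟩ := hcpt.exists_isGreatest ⟨_, hphi⟩
  exact ⟨c, hc, hc.2 hphi, TwiseCRS.le_phi_add_of_mem_achievable hn hc.1⟩
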